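/- Let $(M,g)$ be a Riemannian manifold and let $(N,J,h)$ and $(P,J^P,k)$ be Kähler manifolds, where $P$ is non-empty and of positive dimension. (All manifolds are finite-dimensional, without boundary.) Let $\phi : M \to N$ be a smooth map. Then the following are equivalent: (i) $\phi$ pulls back local pluriharmonic maps from $N$ to $P$ to harmonic maps on $M$: for every open set $U \subseteq N$ and every smooth pluriharmonic map $\psi : U \to P$, the map $\psi\circ\phi : \phi^{-1}(U) \to P$ is harmonic; (ii) $\phi$ is a pseudo harmonic morphism. Here a smooth map $f$ between Riemannian manifolds is harmonic if its tension field $\tau(f) = \operatorname{tr}\nabla df$ vanishes. A smooth map $\psi$ from a complex manifold to a Riemannian manifold is pluriharmonic if $\nabla^{(0,1)}d'\psi = 0$, that is, in local complex coordinates $(z^\alpha)$ on the source and real coordinates on the target, with $\Gamma$ the Christoffel symbols of the target, $$\frac{\partial^2\psi^A}{\partial z^\alpha\,\partial \bar z^\beta} + \Gamma^A_{JL}\,\frac{\partial\psi^J}{\partial z^\alpha}\frac{\partial\psi^L}{\partial\bar z^\beta} = 0 \qquad\text{for all } A,\alpha,\beta .$$ The map $\phi$ is a pseudo harmonic morphism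 if it is harmonic and pseudo horizontally weakly conformal, that is, $[d\phi_x\circ (d\phi_x)^*, J] = 0$ on $T_{\phi(x)}N$ for every $x \in M$, where $(d\phi_x)^* : T_{\phi(x)}N \to T_xM$ is the adjoint of $d\phi_x$ with respect to $g$ and $h$. -/

import Mathlib

open Set Bundle
open scoped Manifold ContDiff Topology

noncomputable section

namespace PHM

/-- A complex manifold is a smooth real manifold for the same charts. -/
instance isManifold_real_of_complex {F : Type*} [NormedAddCommGroup F] [NormedSpace ℂ F]
    {N : Type*} [TopologicalSpace N] [ChartedSpace F N] [IsManifold 𝓘(ℂ, F) ω N] :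
    IsManifold 𝓘(ℝ, F) ∞ N := by
  apply isManifold_of_contDiffOn
  intro e e' he he'
  have h := (contDiffGroupoid ω 𝓘(ℂ, F)).compatible he he'
  have h1 := (mem_groupoid_of_pregroupoid (PG := contDiffPregroupoid ω 𝓘(ℂ, F))).1 h
  exact (ContDiffOn.restrict_scalars ℝ h1.1).of_le le_top

section Real

variable {E : Type*} [NormedAddCommGroup E] [NormedSpace ℝ E]
  {M : Type*} [TopologicalSpace M] [ChartedSpace E M] [IsManifold 𝓘(ℝ, E) ∞ M]

/-- A smooth Riemannian metric on the manifold `M` modelled on the real normed space `E`. -/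
abbrev RMetric (E : Type*) [NormedAddCommGroup E] [NormedSpace ℝ E]
    (M : Type*) [TopologicalSpace M] [ChartedSpace E M] [IsManifold 𝓘(ℝ, E) ∞ M] : Type _ :=
  ContMDiffRiemannianMetric 𝓘(ℝ, E) ∞ E (fun x : M ↦ TangentSpace 𝓘(ℝ, E) x)

/-- The metric coefficients in the preferred chart at `x`: at the point `y` of the chart target,
the bilinear form on `E` obtained by pulling back the metric by the inverse of the chart. -/
def localMetric (g : RMetric E M) (x : M) (y : E) : E →L[ℝ] E →L[ℝ] ℝ :=
  let A : E →L[ℝ] E := mfderiv 𝓘(ℝ, E) 𝓘(ℝ, E) (extChartAt 𝓘(ℝ, E) x).symm y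
  let B : E →L[ℝ] E →L[ℝ] ℝ := g.inner ((extChartAt 𝓘(ℝ, E) x).symm y)
  B.bilinearComp A A

set_option synthInstance.maxHeartbeats 200000 in
/-- The Christoffel symbols of the Levi-Civita connection at `x`, in the preferred chart at `x`:
`Γ(u,v)` is the vector with
`G(Γ(u,v), w) = (∂_u G(v,w) + ∂_v G(u,w) - ∂_w G(u,v)) / 2` for all `w`. -/
def christoffel (g : RMetric E M) (x : M) (u v : E) : E :=
  let y : E := extChartAt 𝓘(ℝ, E) x x
  let DG : E →L[ℝ] E →L[ℝ] E →L[ℝ] ℝ := fderiv ℝ (localMetric g x) y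
  (localMetric g x y).inverse
    ((1 / 2 : ℝ) • (DG u v + DG v u - (DG.flip u).flip v))

variable {F : Type*} [NormedAddCommGroup F] [NormedSpace ℝ F]
  {N : Type*} [TopologicalSpace N] [ChartedSpace F N] [IsManifold 𝓘(ℝ, F) ∞ N]

/-- For `f : X → Y` and a metric `h` on `Y`, the bilinear expression
`∂_u ∂_v f + Γ(∂_u f, ∂_v f)` at `x` in the preferred charts at `x` and `f x`, where `Γ` are the
Christoffel symbols of `h`: this is `∇_u (df (v))` for the pulled back Levi-Civita connection and
constant vector fields `u`, `v` in the chart. No metric on the source enters. -/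
def pullbackHessian {X : Type*} [TopologicalSpace X] [ChartedSpace E X]
    (h : RMetric F N) (f : X → N) (x : X) (u v : E) : F :=
  let fhat : E → F := writtenInExtChartAt 𝓘(ℝ, E) 𝓘(ℝ, F) x f
  let y : E := extChartAt 𝓘(ℝ, E) x x
  fderiv ℝ (fderiv ℝ fhat) y u v + christoffel h (f x) (fderiv ℝ fhat y u) (fderiv ℝ fhat y v)

/-- The second fundamental form `∇df` of a map between Riemannian manifolds at `x`, in the
preferred charts at `x` and `f x`. -/
def secondFundamentalForm (g : RMetric E M) (h : RMetric F N) (f : M → N) (x : M) (u v : E) : F :=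
  pullbackHessian h f x u v -
    fderiv ℝ (writtenInExtChartAt 𝓘(ℝ, E) 𝓘(ℝ, F) x f) (extChartAt 𝓘(ℝ, E) x x)
      (christoffel g x u v)

/-- The inverse metric coefficients `g^{ij}` at `x` in the preferred chart at `x`, with respect to
a fixed basis of the (finite-dimensional) model space: the inner product, for the dual metric, of
the coordinate covectors `dx^i` and `dx^j`. -/
def inverseMetric [FiniteDimensional ℝ E] (g : RMetric E M) (x : M)
    (i j : Fin (Module.finrank ℝ E)) : ℝ :=
  (Module.finBasis ℝ E).coord j ((localMetric g x (extChartAt 𝓘(ℝ, E) x x)).inverse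
    (LinearMap.toContinuousLinearMap ((Module.finBasis ℝ E).coord i)))

/-- The tension field `τ(f) = tr_g ∇df = g^{ij} (∇df)(∂_i, ∂_j)` at `x`, a tangent vector
at `f x` read in the preferred chart at `f x`. -/
def tensionField [FiniteDimensional ℝ E] (g : RMetric E M) (h : RMetric F N) (f : M → N) (x : M) :
    F :=
  ∑ i, ∑ j, inverseMetric g x i j •
    secondFundamentalForm g h f x (Module.finBasis ℝ E i) (Module.finBasis ℝ E j)

/-- `f` is (smooth and) harmonic on the set `U`; used for open `U`. -/
def IsHarmonicOn [FiniteDimensional ℝ E] (g : RMetric E M) (h : RMetric F N) (f : M → N)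
    (U : Set M) : Prop :=
  ContMDiffOn 𝓘(ℝ, E) 𝓘(ℝ, F) ∞ f U ∧ ∀ x ∈ U, tensionField g h f x = 0

/-- The adjoint `(df_x)^* : T_{f x} N → T_x M` of the differential with respect to the two
metrics: `g((df_x)^* v, u) = h(v, df_x u)`. -/
def adjointDifferential (g : RMetric E M) (h : RMetric F N) (f : M → N) (x : M)
    (v : TangentSpace 𝓘(ℝ, F) (f x)) : TangentSpace 𝓘(ℝ, E) x :=
  (g.inner x).inverse ((h.inner (f x) v).comp (mfderiv 𝓘(ℝ, E) 𝓘(ℝ, F) f x))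

end Real

section Complex

variable {F : Type*} [NormedAddCommGroup F] [NormedSpace ℂ F]
  {N : Type*} [TopologicalSpace N] [ChartedSpace F N]

/-- The complex structure on the tangent spaces of a complex manifold: multiplication by `i` in
the preferred (holomorphic) chart. -/
def J (x : N) : TangentSpace 𝓘(ℝ, F) x →L[ℝ] TangentSpace 𝓘(ℝ, F) x :=
  (Complex.I • ContinuousLinearMap.id ℝ F : F →L[ℝ] F)

/-- `h` is a Kähler metric on the complex manifold `N`: it is Hermitian and its fundamental form
`Ω(v, w) = h(Jv, w)` is closed, i.e.
`dΩ(u,v,w) = ∂_u Ω(v,w) + ∂_v Ω(w,u) + ∂_w Ω(u,v)` vanishes (in holomorphic charts, where `J` is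
multiplication by `i`, on constant vector fields). -/
structure IsKahler [IsManifold 𝓘(ℂ, F) ω N] (h : RMetric F N) : Prop where
  hermitian : ∀ (x : N) (v w : TangentSpace 𝓘(ℝ, F) x),
    h.inner x (J x v) (J x w) = h.inner x v w
  closed : ∀ (x : N) (u v w : F),
    fderiv ℝ (fun y ↦ localMetric h x y (Complex.I • v) w) (extChartAt 𝓘(ℝ, F) x x) u +
    fderiv ℝ (fun y ↦ localMetric h x y (Complex.I • w) u) (extChartAt 𝓘(ℝ, F) x x) v +
    fderiv ℝ (fun y ↦ localMetric h x y (Complex.I • u) v) (extChartAt 𝓘(ℝ, F) x x) w = 0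

/-- `ψ : N → P` from a complex manifold to a Riemannian manifold is (smooth and) pluriharmonic on
the set `U` (used for open `U`): `∇^{(0,1)} d'ψ = 0`. With `S(u,v) = ∂_u ∂_v ψ + Γ(∂_u ψ, ∂_v ψ)`
extended complex bilinearly, `Z̄ = (u + iJu)/2` and `W = (v - iJv)/2`, one has
`4 (∇^{(0,1)} d'ψ)(Z̄, W) = 4 S(Z̄, W) = (S(u,v) + S(Ju,Jv)) + i (S(Ju,v) - S(u,Jv))`, as constant
`(1,0)`-fields in a holomorphic chart are holomorphic; the two equations below say that the real
and imaginary parts vanish. -/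
def IsPluriharmonicOn
    {Q : Type*} [NormedAddCommGroup Q] [NormedSpace ℝ Q]
    {P : Type*} [TopologicalSpace P] [ChartedSpace Q P] [IsManifold 𝓘(ℝ, Q) ∞ P]
    (k : RMetric Q P) (ψ : N → P) (U : Set N) : Prop :=
  ContMDiffOn 𝓘(ℝ, F) 𝓘(ℝ, Q) ∞ ψ U ∧ ∀ x ∈ U, ∀ u v : F,
    pullbackHessian k ψ x u v +
      pullbackHessian k ψ x (Complex.I • u) (Complex.I • v) = 0 ∧
    pullbackHessian k ψ x (Complex.I • u) v -
      pullbackHessian k ψ x u (Complex.I • v) = 0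

variable [IsManifold 𝓘(ℂ, F) ω N]
  {E : Type*} [NormedAddCommGroup E] [NormedSpace ℝ E]
  {M : Type*} [TopologicalSpace M] [ChartedSpace E M] [IsManifold 𝓘(ℝ, E) ∞ M]

/-- Pseudo horizontal weak conformality: `[dφ ∘ (dφ)^*, J] = 0`. -/
def IsPHWC (g : RMetric E M) (h : RMetric F N) (φ : M → N) : Prop :=
  ∀ (x : M) (v : TangentSpace 𝓘(ℝ, F) (φ x)),
    mfderiv 𝓘(ℝ, E) 𝓘(ℝ, F) φ x (adjointDifferential g h φ x (J (φ x) v)) =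
      J (φ x) (mfderiv 𝓘(ℝ, E) 𝓘(ℝ, F) φ x (adjointDifferential g h φ x v))

/-- A pseudo harmonic morphism is a harmonic map which is pseudo horizontally weakly conformal. -/
def IsPseudoHarmonicMorphism [FiniteDimensional ℝ E] (g : RMetric E M) (h : RMetric F N)
    (φ : M → N) : Prop :=
  IsHarmonicOn g h φ univ ∧ IsPHWC g h φ

/-- `φ : M → N` pulls back local pluriharmonic maps from `N` to `P` to harmonic maps on `M`. Local
maps are defined on open subsets `U`; the values of `ψ` outside `U` play no role. -/
def PullsBackPluriharmonic [FiniteDimensional ℝ E]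
    {Q : Type*} [NormedAddCommGroup Q] [NormedSpace ℝ Q]
    {P : Type*} [TopologicalSpace P] [ChartedSpace Q P] [IsManifold 𝓘(ℝ, Q) ∞ P]
    (g : RMetric E M) (k : RMetric Q P) (φ : M → N) : Prop :=
  ∀ (U : Set N) (ψ : N → P), IsOpen U → IsPluriharmonicOn (F := F) k ψ U →
    IsHarmonicOn g k (ψ ∘ φ) (φ ⁻¹' U)

end Complex

end PHM

end

noncomputable section

namespace PHM

/-! The engine is the composition law `tensionField_comp`: τ(ψ∘φ) = dψ(τ(φ)) + tr_g (∇dψ)(dφ, dφ).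
By `metricTrace_comp` the trace depends on φ only through T = dφ ∘ g⁻¹ ∘ dφᵗ : F* → F, the
push-forward of the dual metric (`pushDual`), and `isPHWC_iff` turns pseudo horizontal weak
conformality into the J-invariance of T.

From (ii) to (i): since N is Kähler, its Christoffel symbols are complex bilinear in holomorphic
charts, so pluriharmonicity of ψ means that the full Hessian ∇dψ has no (1,1)-part
(`IsPluriharmonicOn.hessianBilin_I`). The trace of such a form against a J-invariant T is zero
(`metricTrace_comp_eq_zero`), which leaves dψ(τ(φ)) = 0.

From (i) to (ii): since P is Kähler, any holomorphic map between charts is pluriharmonic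
(`IsKahler.exists_isPluriharmonicOn`), so test maps abound. A test map λ²·q, with λ a complex linear
functional vanishing at the base point, has zero differential and Hessian 2 λ⊗λ·q there; harmonicity
of the pull-back forces T to be J-invariant. The trace term then drops out for every pluriharmonic
ψ, and the test maps λ·q give λ(τ(φ)) = 0 for all λ. -/

/-- The differential at `x` of a map between manifolds, read in the preferred charts. -/
def chartDeriv {E : Type*} [NormedAddCommGroup E] [NormedSpace ℝ E]
    {M : Type*} [TopologicalSpace M] [ChartedSpace E M]
    {F : Type*} [NormedAddCommGroup F] [NormedSpace ℝ F]
    {N : Type*} [TopologicalSpace N] [ChartedSpace F N] (f : M → N) (x : M) : E →L[ℝ] F :=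
  fderiv ℝ (writtenInExtChartAt 𝓘(ℝ, E) 𝓘(ℝ, F) x f) (extChartAt 𝓘(ℝ, E) x x)

/-! ### Metric coefficients and Christoffel symbols in the preferred charts. -/

section Real

lemma mfderiv_eq_chartDeriv {E : Type*} [NormedAddCommGroup E] [NormedSpace ℝ E]
    {M : Type*} [TopologicalSpace M] [ChartedSpace E M]
    {F : Type*} [NormedAddCommGroup F] [NormedSpace ℝ F]
    {N : Type*} [TopologicalSpace N] [ChartedSpace F N] {f : M → N} {x : M}
    (h : MDifferentiableAt 𝓘(ℝ, E) 𝓘(ℝ, F) f x) :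
    @Eq (E →L[ℝ] F) (mfderiv 𝓘(ℝ, E) 𝓘(ℝ, F) f x) (chartDeriv f x) := by
  have h1 : mfderiv 𝓘(ℝ, E) 𝓘(ℝ, F) f x = _ := if_pos h
  refine h1.trans ?_
  rw [modelWithCornersSelf_coe, range_id, fderivWithin_univ]
  rfl

variable {E : Type*} [NormedAddCommGroup E] [NormedSpace ℝ E]
  {M : Type*} [TopologicalSpace M] [ChartedSpace E M] [IsManifold 𝓘(ℝ, E) ∞ M]

/-- As `E` is finite-dimensional, an operator-valued map amounts to finitely many of its values on
vectors. -/
lemma differentiableAt_clm_of_apply {D E F : Type*} [NormedAddCommGroup D] [NormedSpace ℝ D]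
    [NormedAddCommGroup E] [NormedSpace ℝ E] [FiniteDimensional ℝ E]
    [NormedAddCommGroup F] [NormedSpace ℝ F] {f : D → E →L[ℝ] F} {y : D}
    (h : ∀ u, DifferentiableAt ℝ (fun z ↦ f z u) y) : DifferentiableAt ℝ f y := by
  let e₁ : E ≃L[ℝ] (Fin (Module.finrank ℝ E) → ℝ) :=
    ContinuousLinearEquiv.ofFinrankEq (Module.finrank_fin_fun ℝ).symm
  let e₂ := (e₁.arrowCongr (1 : F ≃L[ℝ] F)).trans
    (ContinuousLinearEquiv.piRing (Fin (Module.finrank ℝ E)))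
  rw [← Function.id_comp f, ← e₂.symm_comp_self]
  exact e₂.symm.differentiableAt.comp y (differentiableAt_pi.2 fun i ↦ h _)

/-- The metric at a point as a bilinear form on the model space. -/
def innerAt (g : RMetric E M) (x : M) : E →L[ℝ] E →L[ℝ] ℝ := g.inner x

/-- The derivative of the inverse of the preferred chart at `x`, read in the preferred charts. -/
def chartSymmDeriv (x : M) (y : E) : E →L[ℝ] E :=
  mfderiv 𝓘(ℝ, E) 𝓘(ℝ, E) (extChartAt 𝓘(ℝ, E) x).symm y

lemma localMetric_apply (g : RMetric E M) (x : M) (y u v : E) :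
    localMetric g x y u v = innerAt g ((extChartAt 𝓘(ℝ, E) x).symm y)
      (chartSymmDeriv x y u) (chartSymmDeriv x y v) := rfl

/-- The manifold derivative at `y` reads its values in the preferred chart at the image of `y`,
which varies with `y`; what results is the derivative of a coordinate change. On a complex manifold
this makes it complex linear. -/
lemma chartSymmDeriv_eq {x : M} {y : E} (hy : y ∈ (extChartAt 𝓘(ℝ, E) x).target) :
    chartSymmDeriv x y =
      fderiv ℝ (extChartAt 𝓘(ℝ, E) ((extChartAt 𝓘(ℝ, E) x).symm y) ∘
        (extChartAt 𝓘(ℝ, E) x).symm) y := by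
  have h : MDifferentiableAt 𝓘(ℝ, E) 𝓘(ℝ, E) (extChartAt 𝓘(ℝ, E) x).symm y :=
    (((contMDiffOn_extChartAt_symm (I := 𝓘(ℝ, E)) (n := ∞) x).mdifferentiableOn (by simp)) y
      hy).mdifferentiableAt ((isOpen_extChartAt_target x).mem_nhds hy)
  exact mfderiv_eq_chartDeriv h

lemma chartSymmDeriv_self (x : M) :
    chartSymmDeriv x (extChartAt 𝓘(ℝ, E) x x) = ContinuousLinearMap.id ℝ E := by
  rw [chartSymmDeriv_eq (mem_extChartAt_target x), extChartAt_to_inv]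
  refine (Filter.EventuallyEq.fderiv_eq (f := id) ?_).trans fderiv_id
  filter_upwards [extChartAt_target_mem_nhds (I := 𝓘(ℝ, E)) x] with y hy
  exact (extChartAt 𝓘(ℝ, E) x).right_inv hy

lemma localMetric_self (g : RMetric E M) (x : M) :
    localMetric g x (extChartAt 𝓘(ℝ, E) x x) = innerAt g x := by
  ext u v
  rw [localMetric_apply, chartSymmDeriv_self, extChartAt_to_inv]
  rfl

lemma innerAt_symm (g : RMetric E M) (x : M) (u v : E) : innerAt g x u v = innerAt g x v u :=
  g.symm _ _ _

lemma innerAt_pos (g : RMetric E M) (x : M) {u : E} (hu : u ≠ 0) : 0 < innerAt g x u u :=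
  g.pos _ _ hu

lemma localMetric_symm (g : RMetric E M) (x : M) (y u v : E) :
    localMetric g x y u v = localMetric g x y v u := by
  rw [localMetric_apply, innerAt_symm, ← localMetric_apply]

/-- Positive definiteness gives injectivity, and dimensions agree. Since `inverse` is zero on
non-invertible maps, this is what gives `christoffel` and `adjointDifferential` their intended
meaning. -/
lemma innerAt_isInvertible [FiniteDimensional ℝ E] (g : RMetric E M) (x : M) :
    (innerAt g x).IsInvertible := by
  let L : E →ₗ[ℝ] (E →L[ℝ] ℝ) := (innerAt g x).toLinearMap
  have hinj : Function.Injective L := by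
    refine (injective_iff_map_eq_zero L).2 fun u hu ↦ ?_
    by_contra h0
    have h1 := innerAt_pos g x h0
    have h2 : innerAt g x u = 0 := hu
    simp [h2] at h1
  have hdim : Module.finrank ℝ E = Module.finrank ℝ (E →L[ℝ] ℝ) := by
    rw [← (LinearMap.toContinuousLinearMap (𝕜 := ℝ) (E := E) (F' := ℝ)).finrank_eq]
    exact (Subspace.dual_finrank_eq (K := ℝ) (V := E)).symm
  exact ⟨(LinearEquiv.ofInjectiveOfFinrankEq L hinj hdim).toContinuousLinearEquiv, by ext; rfl⟩

set_option synthInstance.maxHeartbeats 200000 in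
/-- The metric coefficients are differentiable at the centre of the chart. -/
lemma differentiableAt_localMetric [FiniteDimensional ℝ E] (g : RMetric E M) (x : M) :
    DifferentiableAt ℝ (localMetric g x) (extChartAt 𝓘(ℝ, E) x x) := by
  have hsymm : ContMDiffOn 𝓘(ℝ, E) 𝓘(ℝ, E) ∞ (extChartAt 𝓘(ℝ, E) x).symm
      (extChartAt 𝓘(ℝ, E) x).target := contMDiffOn_extChartAt_symm x
  have hmem := extChartAt_target_mem_nhds (I := 𝓘(ℝ, E)) x
  -- The coordinate vector fields are C¹ along the inverse chart, because the tangent map of a C²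
  -- map is C¹. Contracting the metric with two of them gives the coefficients.
  have hvec (u : E) : ContMDiffAt 𝓘(ℝ, E) (𝓘(ℝ, E).prod 𝓘(ℝ, E)) 1
      (fun y : E ↦ TotalSpace.mk' E (E := (TangentSpace 𝓘(ℝ, E) : M → Type _))
        ((extChartAt 𝓘(ℝ, E) x).symm y) (chartSymmDeriv x y u))
      (extChartAt 𝓘(ℝ, E) x x) := by
    have h2 := (hsymm.of_le (WithTop.coe_le_coe.2 (le_top : (2 : ℕ∞) ≤ ⊤))).contMDiffOn_tangentMapWithin (m := 1) (n := 2)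
      (hmn := by norm_num)
      (isOpen_extChartAt_target x).uniqueMDiffOn
    have h3 : ContMDiff 𝓘(ℝ, E) (𝓘(ℝ, E).prod 𝓘(ℝ, E)) 1
        (fun y : E ↦ TotalSpace.mk' E (E := (TangentSpace 𝓘(ℝ, E) : E → Type _)) y u) := by
      exact contMDiff_vectorSpace_iff_contDiff.2 contDiff_const
    have h4 := (h2.comp h3.contMDiffOn (s := (extChartAt 𝓘(ℝ, E) x).target)
      (fun y hy ↦ hy)).contMDiffAt hmem
    refine h4.congr_of_eventuallyEq ?_
    filter_upwards [hmem] with y hy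
    have h5 := mfderivWithin_of_isOpen (I := 𝓘(ℝ, E)) (I' := 𝓘(ℝ, E))
      (f := (extChartAt 𝓘(ℝ, E) x).symm) (isOpen_extChartAt_target x) hy
    simp only [Function.comp_apply, tangentMapWithin, h5]
    rfl
  have hcoord (u v : E) : DifferentiableAt ℝ (fun y ↦ localMetric g x y u v)
      (extChartAt 𝓘(ℝ, E) x x) := by
    have h1 : ContMDiffAt 𝓘(ℝ, E) (𝓘(ℝ, E).prod 𝓘(ℝ, E →L[ℝ] E →L[ℝ] ℝ)) 1
        (fun y : E ↦ TotalSpace.mk' (E →L[ℝ] E →L[ℝ] ℝ)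
          (E := fun z : M ↦ TangentSpace 𝓘(ℝ, E) z →L[ℝ] TangentSpace 𝓘(ℝ, E) z →L[ℝ] ℝ)
          ((extChartAt 𝓘(ℝ, E) x).symm y) (g.inner ((extChartAt 𝓘(ℝ, E) x).symm y)))
        (extChartAt 𝓘(ℝ, E) x x) :=
      (g.contMDiff.of_le (by exact_mod_cast le_top)).contMDiffAt.comp (extChartAt 𝓘(ℝ, E) x x)
        ((hsymm.contMDiffAt hmem).of_le (by exact_mod_cast le_top))
    have h2 : ContMDiffAt 𝓘(ℝ, E) (𝓘(ℝ, E).prod 𝓘(ℝ, ℝ)) 1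
        (fun y : E ↦ TotalSpace.mk' ℝ (E := Bundle.Trivial M ℝ)
          ((extChartAt 𝓘(ℝ, E) x).symm y) (g.inner ((extChartAt 𝓘(ℝ, E) x).symm y)
            (chartSymmDeriv x y u) (chartSymmDeriv x y v))) (extChartAt 𝓘(ℝ, E) x x) := by
      apply ContMDiffAt.clm_bundle_apply₂ (F₁ := E) (F₂ := E)
      · exact h1
      · exact hvec u
      · exact hvec v
    rw [contMDiffAt_totalSpace] at h2
    exact (h2.2.contDiffAt.differentiableAt one_ne_zero)
  exact differentiableAt_clm_of_apply fun u ↦ differentiableAt_clm_of_apply (hcoord u)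

set_option synthInstance.maxHeartbeats 200000 in
/-- The Koszul formula in the preferred chart. -/
lemma innerAt_christoffel [FiniteDimensional ℝ E] (g : RMetric E M) (x : M) (u v w : E) :
    innerAt g x (christoffel g x u v) w =
      (1 / 2) * (fderiv ℝ (localMetric g x) (extChartAt 𝓘(ℝ, E) x x) u v w +
        fderiv ℝ (localMetric g x) (extChartAt 𝓘(ℝ, E) x x) v u w -
        fderiv ℝ (localMetric g x) (extChartAt 𝓘(ℝ, E) x x) w u v) := by
  simp only [christoffel]
  rw [localMetric_self, (innerAt_isInvertible g x).self_apply_inverse]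
  rfl

lemma innerAt_ext [FiniteDimensional ℝ E] (g : RMetric E M) (x : M) {u v : E}
    (h : ∀ w, innerAt g x u w = innerAt g x v w) : u = v :=
  (innerAt_isInvertible g x).injective (ContinuousLinearMap.ext h)

/-- Links the two ways of differentiating the metric: `IsKahler.closed` differentiates scalar
coefficients, `christoffel` the form-valued map. -/
lemma fderiv_localMetric_apply [FiniteDimensional ℝ E] (g : RMetric E M) (x : M) (u v w : E) :
    fderiv ℝ (fun y ↦ localMetric g x y v w) (extChartAt 𝓘(ℝ, E) x x) u =
      fderiv ℝ (localMetric g x) (extChartAt 𝓘(ℝ, E) x x) u v w := by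
  have h := (((differentiableAt_localMetric g x).hasFDerivAt.clm_apply
    (hasFDerivAt_const v _)).clm_apply (hasFDerivAt_const w _)).fderiv
  rw [h]
  simp

lemma fderiv_localMetric_symm [FiniteDimensional ℝ E] (g : RMetric E M) (x : M) (u v w : E) :
    fderiv ℝ (localMetric g x) (extChartAt 𝓘(ℝ, E) x x) u v w =
      fderiv ℝ (localMetric g x) (extChartAt 𝓘(ℝ, E) x x) u w v := by
  simp only [← fderiv_localMetric_apply, localMetric_symm g x _ v w]

lemma christoffel_symm [FiniteDimensional ℝ E] (g : RMetric E M) (x : M) (u v : E) :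
    christoffel g x u v = christoffel g x v u := by
  refine innerAt_ext g x fun w ↦ ?_
  rw [innerAt_christoffel, innerAt_christoffel, fderiv_localMetric_symm g x w u v]
  ring

end Real

/-! ### Kähler metrics in holomorphic charts. -/

section Complex

variable {F : Type*} [NormedAddCommGroup F] [NormedSpace ℂ F]
  {N : Type*} [TopologicalSpace N] [ChartedSpace F N] [IsManifold 𝓘(ℂ, F) ω N]

/-- Changes of preferred charts of a complex manifold are holomorphic. -/
lemma contDiffAt_coordChange (x x' : N) {y : F} (hy : y ∈ (extChartAt 𝓘(ℝ, F) x).target)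
    (hy' : (extChartAt 𝓘(ℝ, F) x).symm y ∈ (extChartAt 𝓘(ℝ, F) x').source) :
    ContDiffAt ℂ ω (extChartAt 𝓘(ℝ, F) x' ∘ (extChartAt 𝓘(ℝ, F) x).symm) y := by
  have h := (contDiffGroupoid ω 𝓘(ℂ, F)).compatible (chart_mem_atlas F x) (chart_mem_atlas F x')
  have h1 := (mem_groupoid_of_pregroupoid (PG := contDiffPregroupoid ω 𝓘(ℂ, F))).1 h
  have h2 : ContDiffOn ℂ ω (chartAt F x' ∘ (chartAt F x).symm)
      ((chartAt F x).symm ≫ₕ chartAt F x').source := by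
    have := h1.1
    simpa [contDiffPregroupoid] using this
  have h3 : y ∈ ((chartAt F x).symm ≫ₕ chartAt F x').source := by
    simpa using And.intro hy hy'
  simpa using h2.contDiffAt (((chartAt F x).symm ≫ₕ chartAt F x').open_source.mem_nhds h3)

lemma fderiv_I_smul {G : Type*} [NormedAddCommGroup G] [NormedSpace ℂ G] {f : F → G} {y : F}
    (hf : DifferentiableAt ℂ f y) (v : F) :
    fderiv ℝ f y (Complex.I • v) = Complex.I • fderiv ℝ f y v := by
  rw [hf.fderiv_restrictScalars ℝ]
  simp

variable {h : RMetric F N}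

lemma IsKahler.innerAt_I (hN : IsKahler h) (x : N) (v w : F) :
    innerAt h x (Complex.I • v) (Complex.I • w) = innerAt h x v w :=
  hN.hermitian x v w

/-- The frame of the chart is transported by a holomorphic coordinate change, whose derivative
commutes with `i`. Hermitian symmetry thus holds on the whole chart target, so it can be
differentiated. -/
lemma IsKahler.localMetric_I (hN : IsKahler h) (x : N) {y : F}
    (hy : y ∈ (extChartAt 𝓘(ℝ, F) x).target) (v w : F) :
    localMetric h x y (Complex.I • v) (Complex.I • w) = localMetric h x y v w := by
  have hd : DifferentiableAt ℂ (extChartAt 𝓘(ℝ, F) ((extChartAt 𝓘(ℝ, F) x).symm y) ∘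
      (extChartAt 𝓘(ℝ, F) x).symm) y :=
    (contDiffAt_coordChange x _ hy (mem_extChartAt_source _)).differentiableAt (by simp)
  rw [localMetric_apply, localMetric_apply, chartSymmDeriv_eq hy, fderiv_I_smul hd,
    fderiv_I_smul hd, hN.innerAt_I]

variable [FiniteDimensional ℂ F]

lemma IsKahler.fderiv_localMetric_I_I (hN : IsKahler h) (x : N) (u v w : F) :
    fderiv ℝ (localMetric h x) (extChartAt 𝓘(ℝ, F) x x) u (Complex.I • v) (Complex.I • w) =
      fderiv ℝ (localMetric h x) (extChartAt 𝓘(ℝ, F) x x) u v w := by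
  rw [← fderiv_localMetric_apply, ← fderiv_localMetric_apply]
  congr 1
  refine Filter.EventuallyEq.fderiv_eq ?_
  filter_upwards [extChartAt_target_mem_nhds (I := 𝓘(ℝ, F)) x] with y hy
  exact hN.localMetric_I x hy v w

lemma IsKahler.fderiv_localMetric_I (hN : IsKahler h) (x : N) (u v w : F) :
    fderiv ℝ (localMetric h x) (extChartAt 𝓘(ℝ, F) x x) u (Complex.I • v) w =
      - fderiv ℝ (localMetric h x) (extChartAt 𝓘(ℝ, F) x x) u v (Complex.I • w) := by
  rw [← hN.fderiv_localMetric_I_I x u v, smul_smul, Complex.I_mul_I]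
  simp

/-- The Christoffel symbols of a Kähler metric in a holomorphic chart are complex linear. -/
lemma IsKahler.christoffel_I_left (hN : IsKahler h) (x : N) (u v : F) :
    christoffel h x (Complex.I • u) v = Complex.I • christoffel h x u v := by
  refine innerAt_ext h x fun w ↦ ?_
  have h0 : innerAt h x (Complex.I • christoffel h x u v) w =
      - innerAt h x (christoffel h x u v) (Complex.I • w) := by
    rw [← hN.innerAt_I, smul_smul, Complex.I_mul_I]
    simp
  rw [h0, innerAt_christoffel, innerAt_christoffel]
  -- Write D for the derivative of the metric. In the sum of dΩ(Iu, Iv, w) = 0 and dΩ(u, Iv, Iw) = 0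
  -- the D_{Iv} terms cancel; what remains, with the skewness of `I`, is the difference of the two
  -- Koszul expressions.
  have c1 := hN.closed x (Complex.I • u) (Complex.I • v) w
  have c2 := hN.closed x u (Complex.I • v) (Complex.I • w)
  simp only [fderiv_localMetric_apply] at c1 c2
  simp only [smul_smul, Complex.I_mul_I, neg_smul, one_smul, map_neg, neg_apply,
    hN.fderiv_localMetric_I_I] at c1 c2
  have e1 := hN.fderiv_localMetric_I x v u w
  have e2 := hN.fderiv_localMetric_I x w u v
  have e3 := fderiv_localMetric_symm h x (Complex.I • v) u w
  linarith

lemma IsKahler.christoffel_I_right (hN : IsKahler h) (x : N) (u v : F) :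
    christoffel h x u (Complex.I • v) = Complex.I • christoffel h x u v := by
  rw [christoffel_symm, hN.christoffel_I_left, christoffel_symm]

end Complex

/-! ### Traces with respect to the metric and the push-forward of the dual metric. -/

section Trace

variable {E : Type*} [NormedAddCommGroup E] [NormedSpace ℝ E] [FiniteDimensional ℝ E]
  {M : Type*} [TopologicalSpace M] [ChartedSpace E M] [IsManifold 𝓘(ℝ, E) ∞ M]
  {F : Type*} [NormedAddCommGroup F] [NormedSpace ℝ F]
  {Q : Type*} [NormedAddCommGroup Q] [NormedSpace ℝ Q]

/-- The trace of a bilinear map with respect to the metric at `x`. -/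
def metricTrace (g : RMetric E M) (x : M) : (E →ₗ[ℝ] E →ₗ[ℝ] Q) →ₗ[ℝ] Q where
  toFun B := ∑ i, ∑ j, inverseMetric g x i j •
    B (Module.finBasis ℝ E i) (Module.finBasis ℝ E j)
  map_add' B C := by simp [Finset.sum_add_distrib]
  map_smul' c B := by simp [Finset.smul_sum, smul_comm c]

lemma metricTrace_apply (g : RMetric E M) (x : M) (B : E →ₗ[ℝ] E →ₗ[ℝ] Q) :
    metricTrace g x B = ∑ i, ∑ j, inverseMetric g x i j •
      B (Module.finBasis ℝ E i) (Module.finBasis ℝ E j) := rfl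

/-- The map `F* → F` given by `A`, the metric at `x` and the transpose of `A`. -/
def pushDual (g : RMetric E M) (x : M) (A : E →L[ℝ] F) (ξ : F →L[ℝ] ℝ) : F :=
  A ((innerAt g x).inverse (ξ.comp A))

omit [FiniteDimensional ℝ E] in
lemma pushDual_neg (g : RMetric E M) (x : M) (A : E →L[ℝ] F) (ξ : F →L[ℝ] ℝ) :
    pushDual g x A (-ξ) = - pushDual g x A ξ := by
  simp [pushDual, ContinuousLinearMap.neg_comp]

/-- Both sides are the dual metric of `g` evaluated on the pulled back covectors `ξ.comp A` and
`η.comp A`. -/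
lemma pushDual_symm (g : RMetric E M) (x : M) (A : E →L[ℝ] F) (ξ η : F →L[ℝ] ℝ) :
    η (pushDual g x A ξ) = ξ (pushDual g x A η) := by
  have key (ξ η : F →L[ℝ] ℝ) : η (pushDual g x A ξ) = innerAt g x
      ((innerAt g x).inverse (η.comp A)) ((innerAt g x).inverse (ξ.comp A)) := by
    rw [(innerAt_isInvertible g x).self_apply_inverse]
    rfl
  rw [key, key, innerAt_symm]

/-- The right-hand side contains `A` only through `pushDual`, so any symmetry of the push-forward
passes to all traces of pulled back forms. -/
lemma metricTrace_comp [FiniteDimensional ℝ F] (g : RMetric E M) (x : M) (A : E →L[ℝ] F)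
    (B : F →ₗ[ℝ] F →ₗ[ℝ] Q) :
    metricTrace g x (B.compl₁₂ (A : E →ₗ[ℝ] F) (A : E →ₗ[ℝ] F)) =
      ∑ a, B (Module.finBasis ℝ F a) (pushDual g x A
        (LinearMap.toContinuousLinearMap ((Module.finBasis ℝ F).coord a))) := by
  let e := Module.finBasis ℝ E
  let f := Module.finBasis ℝ F
  let R : (E →L[ℝ] ℝ) →L[ℝ] E := (innerAt g x).inverse
  let c (i) : E →L[ℝ] ℝ := LinearMap.toContinuousLinearMap (e.coord i)
  have h1 (i) : ∑ j, inverseMetric g x i j • A (e j) = A (R (c i)) := by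
    have : R (c i) = ∑ j, inverseMetric g x i j • e j := by
      rw [← e.sum_repr (R (c i))]
      refine Finset.sum_congr rfl fun j _ ↦ ?_
      simp only [inverseMetric, localMetric_self]
      simp [e, R, c]
    rw [this, map_sum]
    simp
  have h2 (ξ : E →L[ℝ] ℝ) : ∑ i, ξ (e i) • c i = ξ := by
    ext v
    conv_rhs => rw [← e.sum_repr v, map_sum]
    rw [sum_apply]
    refine Finset.sum_congr rfl fun i _ ↦ ?_
    simp [c, mul_comm]
  have h3 (i) : A (e i) = ∑ a, f.coord a (A (e i)) • f a := by
    simp [Module.Basis.sum_repr]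
  calc metricTrace g x (B.compl₁₂ (A : E →ₗ[ℝ] F) (A : E →ₗ[ℝ] F))
      = ∑ i, B (A (e i)) (A (R (c i))) := by
        simp only [metricTrace_apply, ← h1, map_sum, map_smul]
        rfl
    _ = ∑ i, ∑ a, B (f a) (f.coord a (A (e i)) • A (R (c i))) := by
        refine Finset.sum_congr rfl fun i _ ↦ ?_
        conv_lhs => rw [h3 i, map_sum, LinearMap.sum_apply]
        refine Finset.sum_congr rfl fun a _ ↦ ?_
        rw [map_smul, map_smul, LinearMap.smul_apply]
    _ = ∑ a, B (f a) (A (R (∑ i, f.coord a (A (e i)) • c i))) := by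
        rw [Finset.sum_comm]
        simp
    _ = _ := by
        refine Finset.sum_congr rfl fun a _ ↦ ?_
        -- The covector Σᵢ fᵃ(A eᵢ) eⁱ is fᵃ ∘ A.
        have := h2 ((LinearMap.toContinuousLinearMap (f.coord a)).comp A)
        simp only [ContinuousLinearMap.comp_apply, LinearMap.coe_toContinuousLinearMap'] at this
        rw [this]
        rfl

lemma metricTrace_comp_mul [FiniteDimensional ℝ F] (g : RMetric E M) (x : M) (A : E →L[ℝ] F)
    (ξ η : F →L[ℝ] ℝ) {B : F →ₗ[ℝ] F →ₗ[ℝ] ℝ} (hB : ∀ u v, B u v = ξ u * η v) :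
    metricTrace g x (B.compl₁₂ (A : E →ₗ[ℝ] F) (A : E →ₗ[ℝ] F)) = ξ (pushDual g x A η) := by
  rw [metricTrace_comp]
  conv_rhs => rw [← (Module.finBasis ℝ F).sum_repr (pushDual g x A η), map_sum]
  refine Finset.sum_congr rfl fun a _ ↦ ?_
  rw [hB, pushDual_symm, map_smul, smul_eq_mul, mul_comm]
  rfl

end Trace

/-! ### Invariance of the push-forward under `i`, and pseudo horizontal weak conformality. -/

section TraceComplex

variable {E : Type*} [NormedAddCommGroup E] [NormedSpace ℝ E] [FiniteDimensional ℝ E]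
  {M : Type*} [TopologicalSpace M] [ChartedSpace E M] [IsManifold 𝓘(ℝ, E) ∞ M]
  {F : Type*} [NormedAddCommGroup F] [NormedSpace ℂ F]

/-- Multiplication by `i` as a real linear map. -/
def mulI (F : Type*) [NormedAddCommGroup F] [NormedSpace ℂ F] : F →L[ℝ] F :=
  Complex.I • ContinuousLinearMap.id ℝ F

@[simp] lemma mulI_apply (v : F) : mulI F v = Complex.I • v := rfl

lemma I_smul_I_smul (v : F) : Complex.I • Complex.I • v = -v := by
  rw [smul_smul, Complex.I_mul_I, neg_one_smul]

omit [FiniteDimensional ℝ E] in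
lemma pushDual_mulI_comp (g : RMetric E M) (x : M) (A : E →L[ℝ] F) (ξ : F →L[ℝ] ℝ) :
    pushDual g x ((mulI F).comp A) ξ = Complex.I • pushDual g x A (ξ.comp (mulI F)) := rfl

/-- If the push-forward of the dual metric is invariant under multiplication by `i`, bilinear maps
without `(1,1)`-part pull back to trace-free ones. -/
lemma metricTrace_comp_eq_zero [FiniteDimensional ℂ F] {Q : Type*} [NormedAddCommGroup Q]
    [NormedSpace ℝ Q] (g : RMetric E M) (x : M) (A : E →L[ℝ] F)
    (hA : ∀ ξ : F →L[ℝ] ℝ, Complex.I • pushDual g x A (ξ.comp (mulI F)) = pushDual g x A ξ)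
    (B : F →ₗ[ℝ] F →ₗ[ℝ] Q)
    (hB : ∀ u v, B (Complex.I • u) (Complex.I • v) = - B u v) :
    metricTrace g x (B.compl₁₂ (A : E →ₗ[ℝ] F) (A : E →ₗ[ℝ] F)) = 0 := by
  -- Replacing `A` by `iA` leaves the push-forward, hence the trace, unchanged, but reverses the
  -- sign of the pulled back form: the trace equals its own negative.
  have h1 : metricTrace g x (B.compl₁₂ (A : E →ₗ[ℝ] F) (A : E →ₗ[ℝ] F)) =
      metricTrace g x (B.compl₁₂ ((mulI F).comp A : E →ₗ[ℝ] F)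
        ((mulI F).comp A : E →ₗ[ℝ] F)) := by
    rw [metricTrace_comp, metricTrace_comp]
    simp only [pushDual_mulI_comp, hA]
  have h2 : B.compl₁₂ ((mulI F).comp A : E →ₗ[ℝ] F) ((mulI F).comp A : E →ₗ[ℝ] F) =
      - B.compl₁₂ (A : E →ₗ[ℝ] F) (A : E →ₗ[ℝ] F) := by
    ext u v
    exact hB (A u) (A v)
  rw [h2, map_neg] at h1
  refine (smul_eq_zero.1 (?_ : (2 : ℝ) • _ = (0 : Q))).resolve_left two_ne_zero
  rw [two_smul]
  exact add_eq_zero_iff_eq_neg.2 h1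

/-- The push-forward of the dual metric is invariant under multiplication by `i` as soon as the
traces of squares of complex linear functionals vanish. -/
lemma I_smul_pushDual_of_sq (g : RMetric E M) (x : M) (A : E →L[ℝ] F)
    (h : ∀ ξ : F →L[ℝ] ℝ, ξ (pushDual g x A ξ) =
      (ξ.comp (mulI F)) (pushDual g x A (ξ.comp (mulI F)))) (ξ : F →L[ℝ] ℝ) :
    Complex.I • pushDual g x A (ξ.comp (mulI F)) = pushDual g x A ξ := by
  have hadd (ξ η : F →L[ℝ] ℝ) : pushDual g x A (ξ + η) = pushDual g x A ξ + pushDual g x A η := by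
    simp [pushDual, ContinuousLinearMap.add_comp]
  refine (SeparatingDual.eq_iff_forall_dual_eq (R := ℝ)).2 fun η ↦ ?_
  -- Polarisation of the quadratic hypothesis; symmetry of `pushDual` merges the two cross terms on
  -- each side.
  have h1 := h (ξ + η)
  have h2 := pushDual_symm g x A ξ η
  have h3 := pushDual_symm g x A (ξ.comp (mulI F)) (η.comp (mulI F))
  simp only [ContinuousLinearMap.add_comp, hadd, add_apply, map_add, h ξ, h η] at h1
  change (η.comp (mulI F)) (pushDual g x A (ξ.comp (mulI F))) = _
  linarith

variable {N : Type*} [TopologicalSpace N] [ChartedSpace F N] [IsManifold 𝓘(ℂ, F) ω N]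

omit [FiniteDimensional ℝ E] in
-- The adjoint of dφ is g⁻¹ ∘ dφᵗ ∘ h, so dφ ∘ dφ* is `pushDual` after the isomorphism F → F* given
-- by `h`. As `h` is Hermitian, this isomorphism turns `i` into minus precomposition with `i`.
lemma isPHWC_iff [FiniteDimensional ℂ F] (g : RMetric E M) {h : RMetric F N} (hN : IsKahler h)
    {φ : M → N} (hφ : ContMDiff 𝓘(ℝ, E) 𝓘(ℝ, F) ∞ φ) :
    IsPHWC g h φ ↔ ∀ (x : M) (ξ : F →L[ℝ] ℝ),
      Complex.I • pushDual g x (chartDeriv φ x) (ξ.comp (mulI F)) =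
        pushDual g x (chartDeriv φ x) ξ := by
  refine forall_congr' fun x ↦ ?_
  have hd := mfderiv_eq_chartDeriv ((hφ x).mdifferentiableAt (by simp))
  simp only [← hd]
  set A : E →L[ℝ] F := mfderiv 𝓘(ℝ, E) 𝓘(ℝ, F) φ x
  have hI (v : F) : innerAt h (φ x) (Complex.I • v) = -(innerAt h (φ x) v).comp (mulI F) := by
    ext w
    have := hN.innerAt_I (φ x) v (Complex.I • w)
    rw [I_smul_I_smul, map_neg] at this
    simp [← this]
  have key (v : F) : (pushDual g x A (innerAt h (φ x) (Complex.I • v)) =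
      Complex.I • pushDual g x A (innerAt h (φ x) v)) ↔
      Complex.I • pushDual g x A ((innerAt h (φ x) v).comp (mulI F)) =
        pushDual g x A (innerAt h (φ x) v) := by
    rw [hI, pushDual_neg]
    constructor
    · intro h1
      rw [← neg_neg (pushDual g x A ((innerAt h (φ x) v).comp (mulI F))), h1, smul_neg,
        I_smul_I_smul, neg_neg]
    · intro h1
      rw [← h1, I_smul_I_smul]
  refine (forall_congr' key).trans ⟨fun H ξ ↦ ?_, fun H v ↦ H _⟩
  obtain ⟨v, rfl⟩ := (innerAt_isInvertible h (φ x)).surjective ξ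
  exact H v

end TraceComplex

/-! ### Second-order chain rule and the composition law for tension fields. -/

lemma fderiv_fderiv_comp {E F G : Type*} [NormedAddCommGroup E] [NormedSpace ℝ E]
    [NormedAddCommGroup F] [NormedSpace ℝ F] [NormedAddCommGroup G] [NormedSpace ℝ G]
    {f : E → F} {k : F → G} {y : E} (hf : ContDiffAt ℝ 2 f y) (hk : ContDiffAt ℝ 2 k (f y))
    (u v : E) :
    fderiv ℝ (fderiv ℝ (k ∘ f)) y u v =
      fderiv ℝ (fderiv ℝ k) (f y) (fderiv ℝ f y u) (fderiv ℝ f y v) +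
        fderiv ℝ k (f y) (fderiv ℝ (fderiv ℝ f) y u v) := by
  have h1 : fderiv ℝ (k ∘ f) =ᶠ[𝓝 y] fun z ↦ (fderiv ℝ k (f z)).comp (fderiv ℝ f z) := by
    have hf1 := hf.eventually (by simp)
    have hk1 := hf.continuousAt.eventually (hk.eventually (by simp))
    filter_upwards [hf1, hk1] with z hz1 hz2
    exact fderiv_comp z (hz2.differentiableAt (by simp)) (hz1.differentiableAt (by simp))
  have hf2 : HasFDerivAt (fderiv ℝ f) (fderiv ℝ (fderiv ℝ f) y) y :=
    ((hf.fderiv_right (m := 1) (by norm_num)).differentiableAt (by simp)).hasFDerivAt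
  have hk2 : HasFDerivAt (fderiv ℝ k) (fderiv ℝ (fderiv ℝ k) (f y)) (f y) :=
    ((hk.fderiv_right (m := 1) (by norm_num)).differentiableAt (by simp)).hasFDerivAt
  have hf3 := (hf.differentiableAt (by simp)).hasFDerivAt
  rw [h1.fderiv_eq, HasFDerivAt.fderiv (f := fun z ↦ (fderiv ℝ k (f z)).comp (fderiv ℝ f z))
    ((hk2.comp y hf3).clm_comp hf2)]
  simp [add_comm]

section Bilinear

variable {E : Type*} [NormedAddCommGroup E] [NormedSpace ℝ E]
  {M : Type*} [TopologicalSpace M] [ChartedSpace E M] [IsManifold 𝓘(ℝ, E) ∞ M]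
  {F : Type*} [NormedAddCommGroup F] [NormedSpace ℝ F] [FiniteDimensional ℝ F]
  {N : Type*} [TopologicalSpace N] [ChartedSpace F N] [IsManifold 𝓘(ℝ, F) ∞ N]

set_option synthInstance.maxHeartbeats 200000 in
lemma christoffel_add_left (h : RMetric F N) (x : N) (u v w : F) :
    christoffel h x (u + v) w = christoffel h x u w + christoffel h x v w := by
  refine innerAt_ext h x fun t ↦ ?_
  rw [map_add, add_apply, innerAt_christoffel, innerAt_christoffel, innerAt_christoffel]
  generalize fderiv ℝ (localMetric h x) _ = T
  rw [map_add T, (T w).map_add, (T t).map_add]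
  simp only [add_apply]
  ring

set_option synthInstance.maxHeartbeats 200000 in
lemma christoffel_smul_left (h : RMetric F N) (x : N) (c : ℝ) (u w : F) :
    christoffel h x (c • u) w = c • christoffel h x u w := by
  refine innerAt_ext h x fun t ↦ ?_
  rw [map_smul, smul_apply, innerAt_christoffel, innerAt_christoffel]
  generalize fderiv ℝ (localMetric h x) _ = T
  rw [T.map_smul, (T w).map_smul, (T t).map_smul]
  simp only [smul_apply, smul_eq_mul]
  ring

/-- The Christoffel symbols as a bilinear map. -/
def christoffelBilin (h : RMetric F N) (x : N) : F →ₗ[ℝ] F →ₗ[ℝ] F :=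
  LinearMap.mk₂ ℝ (christoffel h x) (christoffel_add_left h x) (christoffel_smul_left h x)
    (fun u v w ↦ by simp only [christoffel_symm h x u, christoffel_add_left])
    (fun c u v ↦ by simp only [christoffel_symm h x u, christoffel_smul_left])

/-- The second derivative as a bilinear map. -/
def secondDerivBilin {G : Type*} [NormedAddCommGroup G] [NormedSpace ℝ G]
    (f : E → G) (y : E) : E →ₗ[ℝ] E →ₗ[ℝ] G :=
  (ContinuousLinearMap.coeLM ℝ).comp (fderiv ℝ (fderiv ℝ f) y : E →ₗ[ℝ] E →L[ℝ] G)

/-- `pullbackHessian` as a bilinear map. -/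
def pullbackHessianBilin {X : Type*} [TopologicalSpace X] [ChartedSpace E X]
    (h : RMetric F N) (f : X → N) (x : X) : E →ₗ[ℝ] E →ₗ[ℝ] F :=
  secondDerivBilin (writtenInExtChartAt 𝓘(ℝ, E) 𝓘(ℝ, F) x f) (extChartAt 𝓘(ℝ, E) x x) +
    (christoffelBilin h (f x)).compl₁₂ ((chartDeriv f x : E →L[ℝ] F) : E →ₗ[ℝ] F) ((chartDeriv f x : E →L[ℝ] F) : E →ₗ[ℝ] F)

variable {Q : Type*} [NormedAddCommGroup Q] [NormedSpace ℝ Q] [FiniteDimensional ℝ Q]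
  {P : Type*} [TopologicalSpace P] [ChartedSpace Q P] [IsManifold 𝓘(ℝ, Q) ∞ P]

/-- The Hessian `∇dψ` at `x` of a map between Riemannian manifolds, as a bilinear map. -/
def hessianBilin (h : RMetric F N) (k : RMetric Q P) (ψ : N → P) (x : N) :
    F →ₗ[ℝ] F →ₗ[ℝ] Q :=
  pullbackHessianBilin k ψ x - (christoffelBilin h x).compr₂ ((chartDeriv ψ x : F →L[ℝ] Q) : F →ₗ[ℝ] Q)

lemma contDiffAt_writtenInExtChartAt {E F M N : Type*} [NormedAddCommGroup E] [NormedSpace ℝ E]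
    [NormedAddCommGroup F] [NormedSpace ℝ F] [TopologicalSpace M] [ChartedSpace E M]
    [TopologicalSpace N] [ChartedSpace F N] {f : M → N} {x : M}
    (hf : ContMDiffAt 𝓘(ℝ, E) 𝓘(ℝ, F) ∞ f x) :
    ContDiffAt ℝ ∞ (writtenInExtChartAt 𝓘(ℝ, E) 𝓘(ℝ, F) x f) (extChartAt 𝓘(ℝ, E) x x) := by
  have h := (contMDiffAt_iff.1 hf).2
  rwa [modelWithCornersSelf_coe, range_id, contDiffWithinAt_univ] at h

lemma writtenInExtChartAt_comp_eventuallyEq {E F Q M N P : Type*}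
    [NormedAddCommGroup E] [NormedSpace ℝ E] [NormedAddCommGroup F] [NormedSpace ℝ F]
    [NormedAddCommGroup Q] [NormedSpace ℝ Q] [TopologicalSpace M] [ChartedSpace E M]
    [TopologicalSpace N] [ChartedSpace F N] [TopologicalSpace P] [ChartedSpace Q P]
    {φ : M → N} {x : M} (ψ : N → P) (hφ : ContinuousAt φ x) :
    writtenInExtChartAt 𝓘(ℝ, E) 𝓘(ℝ, Q) x (ψ ∘ φ) =ᶠ[𝓝 (extChartAt 𝓘(ℝ, E) x x)]
      writtenInExtChartAt 𝓘(ℝ, F) 𝓘(ℝ, Q) (φ x) ψ ∘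
        writtenInExtChartAt 𝓘(ℝ, E) 𝓘(ℝ, F) x φ := by
  have h := writtenInExtChartAt_comp (I := 𝓘(ℝ, E)) (I' := 𝓘(ℝ, F)) (I'' := 𝓘(ℝ, Q)) (g := ψ)
    (continuousWithinAt_univ φ x |>.2 hφ)
  simpa using h

omit [FiniteDimensional ℝ F] [FiniteDimensional ℝ Q] in
-- In the second-order chain rule the Christoffel symbols of the middle manifold enter ∇dφ with a
-- plus sign and ∇dψ with a minus sign, and cancel.
lemma secondFundamentalForm_comp (g : RMetric E M) (h : RMetric F N) (k : RMetric Q P)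
    {φ : M → N} {ψ : N → P} {x : M} (hφ : ContMDiffAt 𝓘(ℝ, E) 𝓘(ℝ, F) ∞ φ x)
    (hψ : ContMDiffAt 𝓘(ℝ, F) 𝓘(ℝ, Q) ∞ ψ (φ x)) (u v : E) :
    secondFundamentalForm g k (ψ ∘ φ) x u v =
      chartDeriv ψ (φ x) (secondFundamentalForm g h φ x u v) +
        secondFundamentalForm h k ψ (φ x) (chartDeriv φ x u) (chartDeriv φ x v) := by
  have hy : writtenInExtChartAt 𝓘(ℝ, E) 𝓘(ℝ, F) x φ (extChartAt 𝓘(ℝ, E) x x) =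
      extChartAt 𝓘(ℝ, F) (φ x) (φ x) := by simp [writtenInExtChartAt]
  have h2 : (2 : ℕ∞ω) ≤ ∞ := WithTop.coe_le_coe.2 (le_top : (2 : ℕ∞) ≤ ⊤)
  have c1 := (contDiffAt_writtenInExtChartAt hφ).of_le h2
  have c2 := (contDiffAt_writtenInExtChartAt hψ).of_le h2
  rw [← hy] at c2
  have e := writtenInExtChartAt_comp_eventuallyEq (E := E) (F := F) (Q := Q) ψ hφ.continuousAt
  have d1 := e.fderiv_eq (𝕜 := ℝ)
  rw [fderiv_comp _ (c2.differentiableAt (by simp)) (c1.differentiableAt (by simp))] at d1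
  have d2 := (e.fderiv (𝕜 := ℝ)).fderiv_eq (𝕜 := ℝ)
  have d3 := fderiv_fderiv_comp c1 c2 u v
  rw [← d2] at d3
  simp only [secondFundamentalForm, pullbackHessian, chartDeriv]
  rw [d3, d1, hy]
  simp only [ContinuousLinearMap.comp_apply, map_add, map_sub, Function.comp_apply]
  abel

/-- The composition law for tension fields. -/
lemma tensionField_comp [FiniteDimensional ℝ E] (g : RMetric E M) (h : RMetric F N)
    (k : RMetric Q P)
    {φ : M → N} {ψ : N → P} {x : M} (hφ : ContMDiffAt 𝓘(ℝ, E) 𝓘(ℝ, F) ∞ φ x)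
    (hψ : ContMDiffAt 𝓘(ℝ, F) 𝓘(ℝ, Q) ∞ ψ (φ x)) :
    tensionField g k (ψ ∘ φ) x = chartDeriv ψ (φ x) (tensionField g h φ x) +
      metricTrace g x ((hessianBilin h k ψ (φ x)).compl₁₂
        ((chartDeriv φ x : E →L[ℝ] F) : E →ₗ[ℝ] F) ((chartDeriv φ x : E →L[ℝ] F) : E →ₗ[ℝ] F)) := by
  simp only [tensionField, secondFundamentalForm_comp g h k hφ hψ, smul_add,
    Finset.sum_add_distrib, map_sum, map_smul]
  rfl

end Bilinear

/-! ### Holomorphic maps as a supply of pluriharmonic maps. -/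

section Holomorphic

variable {F : Type*} [NormedAddCommGroup F] [NormedSpace ℂ F]
  {Q : Type*} [NormedAddCommGroup Q] [NormedSpace ℂ Q]

/-- Complex linearity of the first derivative holds near `y`, so that identity may be differentiated
once more. -/
lemma fderiv_fderiv_I_right {f : F → Q} {y : F} (hf : ContDiffAt ℂ 2 f y) (u v : F) :
    fderiv ℝ (fderiv ℝ f) y u (Complex.I • v) = Complex.I • fderiv ℝ (fderiv ℝ f) y u v := by
  have hd : DifferentiableAt ℝ (fderiv ℝ f) y :=
    ((hf.restrict_scalars ℝ).fderiv_right (m := 1) (by norm_num)).differentiableAt (by simp)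
  have h1 (w : F) : fderiv ℝ (fderiv ℝ f) y u w = fderiv ℝ (fun z ↦ fderiv ℝ f z w) y u := by
    rw [(hd.hasFDerivAt.clm_apply (hasFDerivAt_const w y)).fderiv]
    simp
  have h2 : (fun z ↦ fderiv ℝ f z (Complex.I • v)) =ᶠ[𝓝 y]
      fun z ↦ mulI Q (fderiv ℝ f z v) := by
    filter_upwards [hf.eventually (by simp)] with z hz
    exact fderiv_I_smul (hz.differentiableAt (by simp)) v
  have h3 := (mulI Q).hasFDerivAt.comp y
    (hd.hasFDerivAt.clm_apply (hasFDerivAt_const v y))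
  rw [h1, h2.fderiv_eq]
  refine (congrArg (fun L : F →L[ℝ] Q ↦ L u) h3.fderiv).trans ?_
  simp

lemma fderiv_fderiv_I_left {f : F → Q} {y : F} (hf : ContDiffAt ℂ 2 f y) (u v : F) :
    fderiv ℝ (fderiv ℝ f) y (Complex.I • u) v = Complex.I • fderiv ℝ (fderiv ℝ f) y u v := by
  have h := (hf.restrict_scalars ℝ).isSymmSndFDerivAt (by simp)
  rw [h.eq, fderiv_fderiv_I_right hf, h.eq]

variable {N : Type*} [TopologicalSpace N] [ChartedSpace F N] [IsManifold 𝓘(ℂ, F) ω N]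
  {P : Type*} [TopologicalSpace P] [ChartedSpace Q P] [IsManifold 𝓘(ℂ, Q) ω P]
  [FiniteDimensional ℂ Q] {k : RMetric Q P}

omit [IsManifold 𝓘(ℂ, F) ω N] in
/-- Holomorphic maps into Kähler manifolds are pluriharmonic. -/
lemma IsKahler.isPluriharmonicOn (hP : IsKahler k) {ψ : N → P} {U : Set N}
    (hψ : ContMDiffOn 𝓘(ℝ, F) 𝓘(ℝ, Q) ∞ ψ U)
    (hol : ∀ x ∈ U, ContDiffAt ℂ 2 (writtenInExtChartAt 𝓘(ℝ, F) 𝓘(ℝ, Q) x ψ)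
      (extChartAt 𝓘(ℝ, F) x x)) :
    IsPluriharmonicOn (F := F) k ψ U := by
  refine ⟨hψ, fun x hx u v ↦ ?_⟩
  have hd := (hol x hx).differentiableAt (by simp)
  -- The form ∂∂ψ + Γ(∂ψ, ∂ψ) is complex bilinear here, so both equations are formal consequences of
  -- i² = -1.
  simp only [pullbackHessian, fderiv_fderiv_I_left (hol x hx), fderiv_fderiv_I_right (hol x hx),
    fderiv_I_smul hd, hP.christoffel_I_left, hP.christoffel_I_right, I_smul_I_smul]
  constructor <;> abel

/-- Every germ of a holomorphic map in charts is realised by a local pluriharmonic map. -/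
lemma IsKahler.exists_isPluriharmonicOn (hP : IsKahler k) (x : N) (p : P) {f : F → Q}
    (hf : ContDiff ℂ ω f) (hfx : f (extChartAt 𝓘(ℝ, F) x x) = extChartAt 𝓘(ℝ, Q) p p) :
    ∃ (U : Set N) (ψ : N → P), IsOpen U ∧ x ∈ U ∧ IsPluriharmonicOn (F := F) k ψ U ∧
      writtenInExtChartAt 𝓘(ℝ, F) 𝓘(ℝ, Q) x ψ =ᶠ[𝓝 (extChartAt 𝓘(ℝ, F) x x)] f := by
  set V : Set N := (extChartAt 𝓘(ℝ, F) x).source ∩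
    extChartAt 𝓘(ℝ, F) x ⁻¹' (f ⁻¹' (extChartAt 𝓘(ℝ, Q) p).target) with hV
  set ψ : N → P := (extChartAt 𝓘(ℝ, Q) p).symm ∘ f ∘ extChartAt 𝓘(ℝ, F) x with hψ
  have hfR : ContDiff ℝ ∞ f := (hf.restrict_scalars ℝ).of_le le_top
  have htarget : IsOpen (f ⁻¹' (extChartAt 𝓘(ℝ, Q) p).target) :=
    (isOpen_extChartAt_target p).preimage hf.continuous
  have hψx : ψ x = p := by
    simp only [hψ, Function.comp_apply, hfx, extChartAt_to_inv]
  refine ⟨V, ψ, ?_, ⟨mem_extChartAt_source x, ?_⟩, hP.isPluriharmonicOn ?_ ?_, ?_⟩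
  · exact (continuousOn_extChartAt x).isOpen_inter_preimage (isOpen_extChartAt_source x) htarget
  · simp only [mem_preimage, hfx]
    exact mem_extChartAt_target p
  · have h1 : ContMDiffOn 𝓘(ℝ, F) 𝓘(ℝ, F) ∞ (extChartAt 𝓘(ℝ, F) x) V :=
      contMDiffOn_extChartAt.mono fun z hz ↦ by simpa using hz.1
    have h2 := hfR.contMDiff.comp_contMDiffOn h1
    exact (contMDiffOn_extChartAt_symm p).comp h2 fun z hz ↦ hz.2
  -- Pluriharmonicity at `z` is expressed in the preferred charts at `z` and `ψ z`. There `ψ` reads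
  -- as `f` between two coordinate changes, all holomorphic.
  · rintro z ⟨hz1, hz2⟩
    have c1 := contDiffAt_coordChange (F := F) z x (mem_extChartAt_target z)
      (by rwa [extChartAt_to_inv])
    have c2 := contDiffAt_coordChange (F := Q) p (ψ z) hz2 (mem_extChartAt_source (ψ z))
    have hz3 : (extChartAt 𝓘(ℝ, F) x ∘ (extChartAt 𝓘(ℝ, F) z).symm) (extChartAt 𝓘(ℝ, F) z z) =
        extChartAt 𝓘(ℝ, F) x z := by simp
    have c3 : ContDiffAt ℂ ω (f ∘ (extChartAt 𝓘(ℝ, F) x ∘ (extChartAt 𝓘(ℝ, F) z).symm))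
      (extChartAt 𝓘(ℝ, F) z z) := hf.contDiffAt.comp _ c1
    have c4 := ContDiffAt.comp (g := extChartAt 𝓘(ℝ, Q) (ψ z) ∘ (extChartAt 𝓘(ℝ, Q) p).symm)
      (extChartAt 𝓘(ℝ, F) z z) (by rw [Function.comp_apply, hz3]; exact c2) c3
    exact c4.of_le le_top
  · have hopen : f ⁻¹' (extChartAt 𝓘(ℝ, Q) p).target ∈ 𝓝 (extChartAt 𝓘(ℝ, F) x x) :=
      htarget.mem_nhds (by simp only [mem_preimage, hfx]; exact mem_extChartAt_target p)
    filter_upwards [hopen, extChartAt_target_mem_nhds (I := 𝓘(ℝ, F)) x] with z hz1 hz2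
    rw [writtenInExtChartAt, hψx]
    simp only [hψ, Function.comp_apply]
    rw [(extChartAt 𝓘(ℝ, F) x).right_inv hz2, (extChartAt 𝓘(ℝ, Q) p).right_inv hz1]

/-- The Hessian of a pluriharmonic map from a Kähler manifold has no `(1,1)`-part. -/
lemma IsPluriharmonicOn.hessianBilin_I [FiniteDimensional ℂ F] {h : RMetric F N}
    (hN : IsKahler h) {ψ : N → P} {U : Set N} (hψ : IsPluriharmonicOn (F := F) k ψ U) {x : N}
    (hx : x ∈ U) (u v : F) :
    hessianBilin h k ψ x (Complex.I • u) (Complex.I • v) = - hessianBilin h k ψ x u v := by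
  have h1 := (hψ.2 x hx u v).1
  change pullbackHessian k ψ x _ _ - chartDeriv ψ x (christoffel h x _ _) =
    -(pullbackHessian k ψ x _ _ - chartDeriv ψ x (christoffel h x _ _))
  -- Pluriharmonicity controls only the part without Christoffel symbols of the source; the Kähler
  -- condition on `N` supplies the same sign rule for those.
  rw [hN.christoffel_I_left, hN.christoffel_I_right, I_smul_I_smul, map_neg,
    eq_neg_of_add_eq_zero_right h1]
  abel

end Holomorphic

/-! ### Derivatives of the quadratic test maps. -/

section Quadratic

variable {F : Type*} [NormedAddCommGroup F] [NormedSpace ℂ F]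
  {Q : Type*} [NormedAddCommGroup Q] [NormedSpace ℂ Q]

lemma fderiv_quadratic (lam : F →L[ℂ] ℂ) (y : F) (c q : Q) (z : F) :
    fderiv ℝ (fun z ↦ c + (lam (z - y) * lam (z - y)) • q) z =
      ((2 * lam (z - y)) • lam.restrictScalars ℝ).smulRight q := by
  have h1 : HasFDerivAt (fun z ↦ lam (z - y)) (lam.restrictScalars ℝ) z :=
    (lam.restrictScalars ℝ).hasFDerivAt.comp z ((hasFDerivAt_id z).sub_const y)
  rw [HasFDerivAt.fderiv (f := fun z ↦ c + (lam (z - y) * lam (z - y)) • q)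
    (((h1.mul h1).smul_const q).const_add c)]
  ext v
  simp [two_mul, add_mul]

lemma fderiv_fderiv_quadratic (lam : F →L[ℂ] ℂ) (y : F) (c q : Q) (u v : F) :
    fderiv ℝ (fderiv ℝ (fun z ↦ c + (lam (z - y) * lam (z - y)) • q)) y u v =
      (2 * (lam u * lam v)) • q := by
  have hs : ContDiff ℝ 2 (fun z ↦ c + (lam (z - y) * lam (z - y)) • q) := by
    have : ContDiff ℝ 2 (fun z ↦ lam (z - y)) :=
      (lam.restrictScalars ℝ).contDiff.comp (contDiff_id.sub contDiff_const)
    exact contDiff_const.add ((this.mul this).smul contDiff_const)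
  have hd : DifferentiableAt ℝ (fderiv ℝ (fun z ↦ c + (lam (z - y) * lam (z - y)) • q)) y :=
    ((hs.fderiv_right (m := 1) (by norm_num)).differentiable (by simp)) y
  have e1 := (hd.hasFDerivAt.clm_apply (hasFDerivAt_const v y)).fderiv
  have h1 : HasFDerivAt (fun z ↦ lam (z - y)) (lam.restrictScalars ℝ) y :=
    (lam.restrictScalars ℝ).hasFDerivAt.comp y ((hasFDerivAt_id y).sub_const y)
  have e2 := (((h1.const_mul 2).mul_const (lam v)).smul_const q).fderiv
  have e3 : (fun z ↦ fderiv ℝ (fun z ↦ c + (lam (z - y) * lam (z - y)) • q) z v) =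
      fun z ↦ (2 * lam (z - y) * lam v) • q := by
    ext z
    rw [fderiv_quadratic]
    simp
  rw [e3, e2] at e1
  have e4 := congrArg (fun L : F →L[ℝ] Q ↦ L u) e1
  simp only [add_apply, ContinuousLinearMap.flip_apply] at e4
  simpa [mul_assoc, mul_comm, mul_left_comm] using e4.symm

end Quadratic

/-! ### The two implications. -/

section Main

variable {E : Type*} [NormedAddCommGroup E] [NormedSpace ℝ E] [FiniteDimensional ℝ E]
  {M : Type*} [TopologicalSpace M] [ChartedSpace E M] [IsManifold 𝓘(ℝ, E) ∞ M]
  {F : Type*} [NormedAddCommGroup F] [NormedSpace ℂ F] [FiniteDimensional ℂ F]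
  {N : Type*} [TopologicalSpace N] [ChartedSpace F N] [IsManifold 𝓘(ℂ, F) ω N]
  {Q : Type*} [NormedAddCommGroup Q] [NormedSpace ℂ Q] [FiniteDimensional ℂ Q]
  {P : Type*} [TopologicalSpace P] [ChartedSpace Q P] [IsManifold 𝓘(ℂ, Q) ω P]
  {g : RMetric E M} {h : RMetric F N} {k : RMetric Q P} {φ : M → N}

/-- The tension field of a pseudo horizontally weakly conformal map followed by a pluriharmonic
map. -/
lemma IsPHWC.tensionField_comp (hφ : IsPHWC g h φ) (hN : IsKahler h)
    (hφs : ContMDiff 𝓘(ℝ, E) 𝓘(ℝ, F) ∞ φ) {U : Set N} (hU : IsOpen U) {ψ : N → P}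
    (hψ : IsPluriharmonicOn (F := F) k ψ U) {x : M} (hx : φ x ∈ U) :
    tensionField g k (ψ ∘ φ) x =
      (chartDeriv ψ (φ x) : F →L[ℝ] Q) (tensionField g h φ x) := by
  rw [PHM.tensionField_comp g h k (hφs x) (hψ.1.contMDiffAt (hU.mem_nhds hx)),
    metricTrace_comp_eq_zero g x _ ((isPHWC_iff g hN hφs).1 hφ x) _ (hψ.hessianBilin_I hN hx),
    add_zero]

/-- Pseudo harmonic morphisms pull back pluriharmonic maps to harmonic maps. -/
lemma IsPseudoHarmonicMorphism.pullsBackPluriharmonic (hφ : IsPseudoHarmonicMorphism g h φ)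
    (hN : IsKahler h) : PullsBackPluriharmonic (F := F) g k φ := by
  intro U ψ hU hψ
  have hφs : ContMDiff 𝓘(ℝ, E) 𝓘(ℝ, F) ∞ φ := contMDiffOn_univ.1 hφ.1.1
  refine ⟨hψ.1.comp hφs.contMDiffOn fun x hx ↦ hx, fun x hx ↦ ?_⟩
  rw [hφ.2.tensionField_comp hN hφs hU hψ hx, hφ.1.2 x (mem_univ x), map_zero]

lemma metricTrace_compr {Q R : Type*} [NormedAddCommGroup Q] [NormedSpace ℝ Q]
    [NormedAddCommGroup R] [NormedSpace ℝ R] (g : RMetric E M) (x : M)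
    (B : E →ₗ[ℝ] E →ₗ[ℝ] Q) (l : Q →ₗ[ℝ] R) :
    metricTrace g x (B.compr₂ l) = l (metricTrace g x B) := by
  simp [metricTrace_apply]

/-- A map pulling back pluriharmonic maps to harmonic maps is pseudo horizontally weakly
conformal: test with squares of complex linear functionals in a holomorphic chart. -/
lemma PullsBackPluriharmonic.isPHWC [Nontrivial Q] [Nonempty P]
    (H : PullsBackPluriharmonic (F := F) g k φ) (hN : IsKahler h) (hP : IsKahler k)
    (hφ : ContMDiff 𝓘(ℝ, E) 𝓘(ℝ, F) ∞ φ) : IsPHWC g h φ := by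
  refine (isPHWC_iff g hN hφ).2 fun x ↦ I_smul_pushDual_of_sq g x _ fun ξ ↦ ?_
  obtain ⟨p⟩ := ‹Nonempty P›
  obtain ⟨q, hq⟩ := exists_ne (0 : Q)
  obtain ⟨μ, hμ⟩ := SeparatingDual.exists_eq_one (R := ℂ) hq
  -- The complex linear functional with real part `ξ`.
  let lam : F →L[ℂ] ℂ := StrongDual.extendRCLike ξ
  have hlam (v : F) : lam v = ξ v - Complex.I * ξ (Complex.I • v) := rfl
  set y := extChartAt 𝓘(ℝ, F) (φ x) (φ x) with hy
  set c := extChartAt 𝓘(ℝ, Q) p p with hc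
  have hf : ContDiff ℂ ω (fun z ↦ c + (lam (z - y) * lam (z - y)) • q) := by
    have : ContDiff ℂ ω (fun z ↦ lam (z - y)) := lam.contDiff.comp (contDiff_id.sub contDiff_const)
    exact contDiff_const.add ((this.mul this).smul contDiff_const)
  obtain ⟨U, ψ, hU, hx, hψ, hev⟩ := hP.exists_isPluriharmonicOn (φ x) p hf (by simp [hy, hc])
  have h0 := (H U ψ hU hψ).2 x hx
  -- The test map is critical at the base point, which removes both τ(φ) and all Christoffel terms.
  have hd1 : (chartDeriv ψ (φ x) : F →L[ℝ] Q) = 0 := by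
    rw [chartDeriv, hev.fderiv_eq, fderiv_quadratic]
    ext v
    simp [hy]
  have hd2 (u v : F) : hessianBilin h k ψ (φ x) u v = (2 * (lam u * lam v)) • q := by
    have h1 : hessianBilin h k ψ (φ x) u v =
        fderiv ℝ (fderiv ℝ (writtenInExtChartAt 𝓘(ℝ, F) 𝓘(ℝ, Q) (φ x) ψ)) y u v +
          christoffelBilin k (ψ (φ x)) ((chartDeriv ψ (φ x) : F →L[ℝ] Q) u)
            ((chartDeriv ψ (φ x) : F →L[ℝ] Q) v) -
          (chartDeriv ψ (φ x) : F →L[ℝ] Q) (christoffelBilin h (φ x) u v) := rfl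
    rw [h1, hd1, hev.fderiv.fderiv_eq, fderiv_fderiv_quadratic]
    simp
  rw [tensionField_comp g h k (hφ x) (hψ.1.contMDiffAt (hU.mem_nhds hx)), hd1,
    zero_apply, zero_add] at h0
  -- Since `μ q = 1`, applying Re μ to the Hessian gives 2 Re(λ⊗λ) = 2(ξ⊗ξ - (ξ∘i)⊗(ξ∘i)); its
  -- vanishing trace is the required equality of squares.
  let l : Q →ₗ[ℝ] ℝ := Complex.reLm.comp (μ.restrictScalars ℝ : Q →ₗ[ℝ] ℂ)
  let B (η : F →L[ℝ] ℝ) : F →ₗ[ℝ] F →ₗ[ℝ] ℝ :=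
    (LinearMap.mul ℝ ℝ).compl₁₂ (η : F →ₗ[ℝ] ℝ) (η : F →ₗ[ℝ] ℝ)
  have hB (η : F →L[ℝ] ℝ) (u v : F) : B η u v = η u * η v := rfl
  have hl : (hessianBilin h k ψ (φ x)).compr₂ l =
      (2 : ℝ) • (B ξ - B (ξ.comp (mulI F))) := by
    ext u v
    have : l ((2 * (lam u * lam v)) • q) = 2 * (ξ u * ξ v - ξ (Complex.I • u) *
        ξ (Complex.I • v)) := by
      simp [l, hμ, hlam]
    simpa [hd2, hB] using this
  have h1 := metricTrace_compr g x ((hessianBilin h k ψ (φ x)).compl₁₂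
        ((chartDeriv φ x : E →L[ℝ] F) : E →ₗ[ℝ] F) ((chartDeriv φ x : E →L[ℝ] F) : E →ₗ[ℝ] F)) l
  rw [h0, map_zero] at h1
  have h2 : ((hessianBilin h k ψ (φ x)).compl₁₂
      ((chartDeriv φ x : E →L[ℝ] F) : E →ₗ[ℝ] F)
      ((chartDeriv φ x : E →L[ℝ] F) : E →ₗ[ℝ] F)).compr₂ l =
      (2 : ℝ) • ((B ξ).compl₁₂ ((chartDeriv φ x : E →L[ℝ] F) : E →ₗ[ℝ] F)
        ((chartDeriv φ x : E →L[ℝ] F) : E →ₗ[ℝ] F) -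
      (B (ξ.comp (mulI F))).compl₁₂ ((chartDeriv φ x : E →L[ℝ] F) : E →ₗ[ℝ] F)
        ((chartDeriv φ x : E →L[ℝ] F) : E →ₗ[ℝ] F)) := by
    ext u v
    exact LinearMap.congr_fun₂ hl _ _
  rw [h2, map_smul, map_sub, metricTrace_comp_mul g x _ _ _ (hB _),
    metricTrace_comp_mul g x _ _ _ (hB _)] at h1
  exact sub_eq_zero.1 ((smul_eq_zero.1 h1).resolve_left two_ne_zero)

/-- A map pulling back pluriharmonic maps to harmonic maps is harmonic: test with complex linear
functionals in a holomorphic chart. -/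
lemma PullsBackPluriharmonic.isHarmonicOn [Nontrivial Q] [Nonempty P]
    (H : PullsBackPluriharmonic (F := F) g k φ) (hN : IsKahler h) (hP : IsKahler k)
    (hφ : ContMDiff 𝓘(ℝ, E) 𝓘(ℝ, F) ∞ φ) : IsHarmonicOn g h φ univ := by
  refine ⟨hφ.contMDiffOn, fun x _ ↦ (SeparatingDual.eq_zero_iff_forall_dual_eq_zero (R := ℂ) _).2
    fun lam ↦ ?_⟩
  obtain ⟨p⟩ := ‹Nonempty P›
  obtain ⟨q, hq⟩ := exists_ne (0 : Q)
  set y := extChartAt 𝓘(ℝ, F) (φ x) (φ x) with hy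
  set c := extChartAt 𝓘(ℝ, Q) p p with hc
  have hf : ContDiff ℂ ω (fun z ↦ c + lam (z - y) • q) :=
    contDiff_const.add
      ((lam.contDiff.comp (contDiff_id.sub contDiff_const)).smul contDiff_const)
  obtain ⟨U, ψ, hU, hx, hψ, hev⟩ := hP.exists_isPluriharmonicOn (φ x) p hf (by simp [hy, hc])
  have h0 := (H U ψ hU hψ).2 x hx
  -- The conformality already obtained kills the trace term, so the Hessian of this affine test map,
  -- Christoffel terms included, need not be computed.
  rw [(H.isPHWC hN hP hφ).tensionField_comp hN hφ hU hψ hx] at h0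
  have h1 : HasFDerivAt (fun z ↦ c + lam (z - y) • q)
      ((lam.restrictScalars ℝ).smulRight q) y :=
    (((lam.restrictScalars ℝ).hasFDerivAt.comp y
      ((hasFDerivAt_id y).sub_const y)).smul_const q).const_add c
  have h2 : (chartDeriv ψ (φ x) : F →L[ℝ] Q) = (lam.restrictScalars ℝ).smulRight q := by
    rw [chartDeriv, hev.fderiv_eq, h1.fderiv]
  rw [h2] at h0
  exact (smul_eq_zero.1 h0).resolve_right hq

end Main
end PHM
end

theorem mainTheorem6
    {E : Type*} [NormedAddCommGroup E] [NormedSpace ℝ E] [FiniteDimensional ℝ E]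
    {M : Type*} [TopologicalSpace M] [ChartedSpace E M] [IsManifold 𝓘(ℝ, E) ∞ M]
    {F : Type*} [NormedAddCommGroup F] [NormedSpace ℂ F] [FiniteDimensional ℂ F]
    {N : Type*} [TopologicalSpace N] [ChartedSpace F N] [IsManifold 𝓘(ℂ, F) ω N]
    {Q : Type*} [NormedAddCommGroup Q] [NormedSpace ℂ Q] [FiniteDimensional ℂ Q] [Nontrivial Q]
    {P : Type*} [TopologicalSpace P] [ChartedSpace Q P] [IsManifold 𝓘(ℂ, Q) ω P] [Nonempty P]
    (g : PHM.RMetric E M) (h : PHM.RMetric F N) (k : PHM.RMetric Q P)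
    (hN : PHM.IsKahler h) (hP : PHM.IsKahler k)
    (φ : M → N) (hφ : ContMDiff 𝓘(ℝ, E) 𝓘(ℝ, F) ∞ φ) :
    PHM.PullsBackPluriharmonic (F := F) g k φ ↔ PHM.IsPseudoHarmonicMorphism g h φ :=
  ⟨fun H ↦ ⟨H.isHarmonicOn hN hP hφ, H.isPHWC hN hP hφ⟩, fun H ↦ H.pullsBackPluriharmonic hN⟩
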